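/- Complex manifolds are Hausdorff, second countable and of pure dimension, but need not be connected. Let $M_0$ be a complex manifold of dimension $N$ and let $1\le n\le N$. An $n$-dimensional complex submanifold of $M_0$ is a subset $S\subset M_0$ (embedded, not necessarily closed or connected) such that around each point of $S$ there is a holomorphic chart of $M_0$ in which $S$ is given by the vanishing of the last $N-n$ coordinates. For $x\in M_0$, two such submanifolds $S_1,S_2\ni x$ have the same germ at $x$ if $S_1\cap W=S_2\cap W$ for some neighbourhood $W$ of $x$ in $M_0$; $[S]_x$ denotes the germ of $S$ at $x$. Let $\mathcal S^n$ be the set of all germs $[S]_x$ with $x\in S$, with the topology generated by the sets $V_S=\{[S]_x : x\in S\}$, and let $\sigma:\mathcal S^n\to M_0$, $[S]_x\mapsto x$. For a topological space $X$ the connected components of $X$ are called its leaves. **Theorem.** The map $\sigma$ is continuous, and the pair $(X,\tau)=(\mathcal S^n,\sigma)$ has the following two properties: 1. Each leaf $\mathcal L$ of $X$ (with the subspace topology) admits a structure of $n$-dimensional complex manifold such that $\tau|_{\mathcal L}$ is a holomorphic immersion. 2. For every $n$-dimensional complex manifold $M$ and every holomorphic immersion $\phi:M\to M_0$ there is a unique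 continuous map $\rho_\phi:M\to X$ such that $\phi=\tau\circ\rho_\phi$. Moreover, the leaves of $\mathcal S^n$ are open. Up to equivalence, $(\mathcal S^n,\sigma)$ is the only such pair: if $X$ is a topological space and $\tau:X\to M_0$ is a continuous map with properties 1 and 2, then there is a continuous bijection $e:\mathcal S^n\to X$ with $\sigma=\tau\circ e$ which maps each leaf of $\mathcal S^n$ biholomorphically onto a leaf of $X$ (for any complex structures as in 1 on the two leaves). If moreover the leaves of $X$ are open in $X$, then $e$ is a homeomorphism. -/

import Mathlib

open scoped Manifold ContDiff Topology

universe u v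

/-- The model space `ℂ^k`. -/
abbrev CSpace (k : ℕ) : Type := EuclideanSpace ℂ (Fin k)

/-- `S` is an (embedded, not necessarily closed or connected) `n`-dimensional complex submanifold
of the `N`-dimensional complex manifold `M₀`: around each of its points there is a holomorphic
chart of `M₀` in which `S` is the slice where the last `N - n` coordinates vanish. -/
def IsComplexSubmanifold (N n : ℕ) {M₀ : Type*} [TopologicalSpace M₀] [ChartedSpace (CSpace N) M₀]
    (S : Set M₀) : Prop :=
  ∀ p ∈ S, ∃ ψ ∈ IsManifold.maximalAtlas 𝓘(ℂ, CSpace N) ω M₀, p ∈ ψ.source ∧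
    ∀ q ∈ ψ.source, (q ∈ S ↔ ∀ i : Fin N, n ≤ (i : ℕ) → ψ q i = 0)

/-- The `n`-dimensional complex submanifolds of `M₀` passing through `x`. -/
def SubmanifoldThrough (N n : ℕ) {M₀ : Type*} [TopologicalSpace M₀] [ChartedSpace (CSpace N) M₀]
    (x : M₀) : Type _ :=
  {S : Set M₀ // IsComplexSubmanifold N n S ∧ x ∈ S}

/-- Two submanifolds through `x` are equivalent if they coincide in a neighbourhood of `x`. -/
def germSetoid (N n : ℕ) {M₀ : Type*} [TopologicalSpace M₀] [ChartedSpace (CSpace N) M₀]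
    (x : M₀) : Setoid (SubmanifoldThrough N n x) where
  r S₁ S₂ := ∃ W ∈ 𝓝 x, S₁.1 ∩ W = S₂.1 ∩ W
  iseqv :=
    { refl := fun _ => ⟨Set.univ, Filter.univ_mem, rfl⟩
      symm := fun ⟨W, hW, h⟩ => ⟨W, hW, h.symm⟩
      trans := by
        rintro S₁ S₂ S₃ ⟨W, hW, h⟩ ⟨W', hW', h'⟩
        refine ⟨W ∩ W', Filter.inter_mem hW hW', ?_⟩
        rw [← Set.inter_assoc, h, Set.inter_right_comm, h', Set.inter_right_comm, Set.inter_assoc] }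

/-- The space of germs of `n`-dimensional complex submanifolds of `M₀`: a point is a point `x`
of `M₀` together with a germ at `x`. -/
def GermSpace (N n : ℕ) (M₀ : Type*) [TopologicalSpace M₀] [ChartedSpace (CSpace N) M₀] : Type _ :=
  Σ x : M₀, Quotient (germSetoid N n x)

namespace GermSpace

variable {N n : ℕ} {M₀ : Type*} [TopologicalSpace M₀] [ChartedSpace (CSpace N) M₀]

/-- The natural projection `σ`, sending a germ at `x` to `x`. -/
def proj (s : GermSpace N n M₀) : M₀ := s.1

/-- The germ `[S]_x`. -/
def germ (S : Set M₀) (hS : IsComplexSubmanifold N n S) (x : M₀) (hx : x ∈ S) :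
    GermSpace N n M₀ :=
  ⟨x, Quotient.mk (germSetoid N n x) ⟨S, hS, hx⟩⟩

/-- The set `V_S` of all germs `[S]_x` with `x ∈ S`. -/
def germsOf (S : Set M₀) (hS : IsComplexSubmanifold N n S) : Set (GermSpace N n M₀) :=
  {s | ∃ (x : M₀) (hx : x ∈ S), s = germ S hS x hx}

/-- The canonical topology, generated by the sets `V_S`. -/
instance : TopologicalSpace (GermSpace N n M₀) :=
  TopologicalSpace.generateFrom
    {V | ∃ (S : Set M₀) (hS : IsComplexSubmanifold N n S), V = germsOf S hS}

end GermSpace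

/-- A structure of `n`-dimensional complex manifold (Hausdorff and second countable, compatible with
the subspace topology) on a subset `L` of `X`, for which the restriction of `τ : X → M₀` to `L` is a
holomorphic immersion. -/
structure LeafStructure (N n : ℕ) {M₀ X : Type*} [TopologicalSpace M₀] [ChartedSpace (CSpace N) M₀]
    [TopologicalSpace X] (τ : X → M₀) (L : Set X) where
  t2 : T2Space L
  secondCountable : SecondCountableTopology L
  [charted : ChartedSpace (CSpace n) L]
  isManifold : IsManifold 𝓘(ℂ, CSpace n) ω L
  isImmersion : Manifold.IsImmersion 𝓘(ℂ, CSpace n) 𝓘(ℂ, CSpace N) ω (fun p : L => τ p)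

/-- The two properties of the pair `(X, τ)`, where `τ : X → M₀` is continuous. The universe `t` is
that of the manifolds `M` in the second property. -/
structure IsUniversalLeafSpace.{t, a, b} (N n : ℕ) {M₀ : Type a} {X : Type b} [TopologicalSpace M₀]
    [ChartedSpace (CSpace N) M₀] [TopologicalSpace X] (τ : X → M₀) : Prop where
  continuous : Continuous τ
  /-- Each leaf is an `n`-dimensional complex manifold immersed by `τ`. -/
  leaf : ∀ s : X, Nonempty (LeafStructure N n τ (connectedComponent s))
  /-- Holomorphic immersions of `n`-dimensional complex manifolds lift uniquely. -/
  lift : ∀ (M : Type t) [TopologicalSpace M] [T2Space M] [SecondCountableTopology M]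
    [ChartedSpace (CSpace n) M] [IsManifold 𝓘(ℂ, CSpace n) ω M] (φ : M → M₀),
    Manifold.IsImmersion 𝓘(ℂ, CSpace n) 𝓘(ℂ, CSpace N) ω φ →
      ∃! ρ : M → X, Continuous ρ ∧ φ = τ ∘ ρ

/-- `e` is an equivalence from `(X, τ)` to `(Y, τ')`: a continuous bijection over `M₀` that
maps each leaf of `X` biholomorphically onto a leaf of `Y`, whichever complex structures, as in
`LeafStructure`, these leaves are given. -/
structure IsLeafEquivalence (N n : ℕ) {M₀ X Y : Type*} [TopologicalSpace M₀]
    [ChartedSpace (CSpace N) M₀] [TopologicalSpace X] [TopologicalSpace Y]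
    (τ : X → M₀) (τ' : Y → M₀) (e : X → Y) : Prop where
  continuous : Continuous e
  bijective : Function.Bijective e
  comp_eq : τ = τ' ∘ e
  biholomorphic : ∀ (s : X) (A : LeafStructure N n τ (connectedComponent s))
    (B : LeafStructure N n τ' (connectedComponent (e s))),
    letI := A.charted
    letI := B.charted
    ∃ d : Diffeomorph 𝓘(ℂ, CSpace n) 𝓘(ℂ, CSpace n) (connectedComponent s)
      (connectedComponent (e s)) ω, ∀ p, (d p : Y) = e p

/-! The projection σ maps `V_S` homeomorphically onto `S`, so slice charts of `M₀` give charts of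
the germ space in which σ reads a ↦ (a, 0). What remains is global.

Leaves are Hausdorff by the identity theorem (`IsComplexSubmanifold.exists_nhds_inter_subset`): two
submanifolds through x with a common germ at points arbitrarily close to x coincide near x. They are
second countable by the Poincaré–Volterra argument, which excludes uncountably many sheets over
`M₀`.

An immersion φ embeds a small neighbourhood `U p` of p onto a submanifold, and p ↦ [φ(U p)] is a
lift. Any other continuous lift has values near p in some `V_T`, so near φ(p) the image lies in `T`;
submanifolds of equal dimension, one inside the other, have equal germs
(`IsComplexSubmanifold.eventuallyEq_of_subset`).

Uniqueness of the pair is the usual argument from a universal property, applied to one leaf at a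
time. The glued maps are a priori continuous only on leaves; open leaves make them continuous. -/

/-! ### Poincaré–Volterra and gluing over connected components -/

section Topology

open Set TopologicalSpace

/-- **Poincaré–Volterra theorem.** A connected, locally connected space `X` with a continuous map
to a second countable space is second countable if every point has a second countable open
neighbourhood which is relatively closed in the preimage of some open set. -/
theorem secondCountableTopology_of_relClosed_nhds {X Y : Type*} [TopologicalSpace X]
    [TopologicalSpace Y] [SecondCountableTopology Y] [LocallyConnectedSpace X]
    [PreconnectedSpace X] {f : X → Y} (hf : Continuous f)
    (h : ∀ x, ∃ V : Set X, IsOpen V ∧ x ∈ V ∧ SecondCountableTopology V ∧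
      ∃ U : Set Y, IsOpen U ∧ f x ∈ U ∧ closure V ∩ f ⁻¹' U ⊆ V) :
    SecondCountableTopology X := by
  let C : Set Y → X → Set X := fun U x => connectedComponentIn (f ⁻¹' U) x
  let 𝔙 : Set (Set X) := {D | SecondCountableTopology D ∧
    ∃ U ∈ countableBasis Y, ∃ x, f x ∈ U ∧ D = C U x}
  have hopen : ∀ D ∈ 𝔙, IsOpen D := by
    rintro D ⟨-, U, hU, x, -, rfl⟩
    exact ((isOpen_of_mem_countableBasis hU).preimage hf).connectedComponentIn
  have hcover : ∀ x, ∃ D ∈ 𝔙, x ∈ D := by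
    intro x
    obtain ⟨V, hV, hxV, hVc, U, hU, hxU, hcl⟩ := h x
    obtain ⟨U', hU', hxU', hUU'⟩ := (isBasis_countableBasis Y).exists_subset_of_mem_open hxU hU
    -- `V` is relatively clopen in `f ⁻¹' U'`, so it contains the component of `x`.
    have hsub : C U' x ⊆ V := by
      have hpre : IsPreconnected (C U' x) := isPreconnected_connectedComponentIn
      have hCU : C U' x ⊆ f ⁻¹' U' := connectedComponentIn_subset _ _
      refine (hpre.subset_or_subset hV isClosed_closure.isOpen_compl
        (disjoint_compl_right.mono_left subset_closure) ?_).resolve_right ?_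
      · intro y hy
        by_cases hyc : y ∈ closure V
        · exact Or.inl (hcl ⟨hyc, hUU' (hCU hy)⟩)
        · exact Or.inr hyc
      · intro hsub
        exact hsub (mem_connectedComponentIn (F := f ⁻¹' U') hxU') (subset_closure hxV)
    refine ⟨C U' x, ⟨?_, U', hU', x, hxU', rfl⟩, mem_connectedComponentIn (F := f ⁻¹' U') hxU'⟩
    exact (Topology.IsEmbedding.inclusion hsub).secondCountableTopology
  -- For fixed `U` the sets `C U x` are disjoint or equal, and open. Each one that meets `A` is thus
  -- the component of a point of a countable dense subset of `A`.
  have hmeet : ∀ A : Set X, SecondCountableTopology A →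
      {D | D ∈ 𝔙 ∧ (A ∩ D).Nonempty}.Countable := by
    intro A hA
    obtain ⟨Q, hQ, hQd⟩ := exists_countable_dense A
    refine (((countable_countableBasis Y).prod hQ).image fun p => C p.1 p.2).mono ?_
    rintro D ⟨hD, y, hyA, hyD⟩
    obtain ⟨q, hqD, hqQ⟩ := hQd.inter_open_nonempty _
      ((hopen D hD).preimage continuous_subtype_val) ⟨⟨y, hyA⟩, hyD⟩
    obtain ⟨-, U, hU, x, -, rfl⟩ := hD
    exact ⟨(U, q), ⟨hU, hqQ⟩, (connectedComponentIn_eq hqD).symm⟩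
  rcases isEmpty_or_nonempty X with hX | ⟨⟨x₀⟩⟩
  · infer_instance
  obtain ⟨D₀, hD₀, hx₀⟩ := hcover x₀
  -- `𝒜 k` holds the end points of chains of `k` successively intersecting members of `𝔙` starting
  -- at `D₀`. The union of all of them is clopen.
  let 𝒜 : ℕ → Set (Set X) := fun k => Nat.rec {D₀}
    (fun _ B => ⋃ A ∈ B, {D | D ∈ 𝔙 ∧ (A ∩ D).Nonempty}) k
  have hsucc : ∀ k, 𝒜 (k + 1) = ⋃ A ∈ 𝒜 k, {D | D ∈ 𝔙 ∧ (A ∩ D).Nonempty} := fun _ => rfl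
  have h𝒜 : ∀ k, 𝒜 k ⊆ 𝔙 ∧ (𝒜 k).Countable := by
    intro k
    induction k with
    | zero => exact ⟨singleton_subset_iff.2 hD₀, countable_singleton D₀⟩
    | succ k ih =>
      rw [hsucc]
      refine ⟨iUnion₂_subset fun A _ D hD => hD.1, ih.2.biUnion fun A hA => hmeet A (ih.1 hA).1⟩
  let 𝒟 : Set (Set X) := ⋃ k, 𝒜 k
  have h𝒟 : 𝒟 ⊆ 𝔙 := iUnion_subset fun k => (h𝒜 k).1
  have hclopen : IsClopen (⋃₀ 𝒟) := by
    refine ⟨isClosed_of_closure_subset fun z hz => ?_, isOpen_sUnion fun D hD => hopen D (h𝒟 hD)⟩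
    obtain ⟨D, hD, hzD⟩ := hcover z
    obtain ⟨y, hyD, A, hA, hyA⟩ := mem_closure_iff.1 hz D (hopen D hD) hzD
    obtain ⟨k, hk⟩ := mem_iUnion.1 hA
    refine ⟨D, mem_iUnion.2 ⟨k + 1, ?_⟩, hzD⟩
    rw [hsucc]
    exact mem_biUnion hk ⟨hD, y, hyA, hyD⟩
  have huniv : ⋃₀ 𝒟 = univ :=
    hclopen.eq_univ ⟨x₀, D₀, mem_iUnion.2 ⟨0, rfl⟩, hx₀⟩
  have : Countable 𝒟 := (countable_iUnion fun k => (h𝒜 k).2).to_subtype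
  have (D : 𝒟) : SecondCountableTopology D.1 := (h𝒟 D.2).1
  exact secondCountableTopology_of_countable_cover (U := fun D : 𝒟 => D.1)
    (fun D => hopen D (h𝒟 D.2)) (by rw [← sUnion_eq_iUnion, huniv])

variable {X Y B : Type*} [TopologicalSpace X] [TopologicalSpace Y] {τ : X → B} {τ' : Y → B}

/-- Unique lifts on the connected components of `X` glue to a map on `X`. -/
theorem exists_lift_of_components
    (h : ∀ s : X, ∃! ρ : connectedComponent s → Y, Continuous ρ ∧ τ ∘ (↑) = τ' ∘ ρ) :
    ∃ e : X → Y, (∀ s, ContinuousOn e (connectedComponent s)) ∧ τ = τ' ∘ e := by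
  -- The lift is chosen per set `C` rather than per base point, so that points with the same
  -- component receive the same lift.
  let P : Set X → Prop := fun C => ∃! ρ : C → Y, Continuous ρ ∧ τ ∘ (↑) = τ' ∘ ρ
  let ρ : ∀ C : Set X, P C → C → Y := fun C hC => hC.choose
  have hρ : ∀ (C D : Set X) (hC : P C) (hD : P D), C = D → ∀ x hx hx',
      ρ C hC ⟨x, hx⟩ = ρ D hD ⟨x, hx'⟩ := by
    rintro C D hC hD rfl x hx hx'
    rfl
  refine ⟨fun s => ρ _ (h s) ⟨s, mem_connectedComponent⟩, fun s => ?_, ?_⟩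
  · rw [continuousOn_iff_continuous_domRestrict]
    refine ((h s).choose_spec.1.1).congr fun x => ?_
    exact hρ _ _ (h s) (h x) (connectedComponent_eq x.2) _ _ _
  · funext s
    exact congrFun (h s).choose_spec.1.2 ⟨s, mem_connectedComponent⟩

/-- Lifts which are continuous on the connected components are unique if this is so on each
component. -/
theorem lift_unique_of_components
    (h : ∀ s : X, ∃! ρ : connectedComponent s → Y, Continuous ρ ∧ τ ∘ (↑) = τ' ∘ ρ)
    {f g : X → Y} (hf : ∀ s, ContinuousOn f (connectedComponent s)) (hfτ : τ = τ' ∘ f)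
    (hg : ∀ s, ContinuousOn g (connectedComponent s)) (hgτ : τ = τ' ∘ g) : f = g := by
  funext s
  have := (h s).unique
    (y₁ := f ∘ (↑)) (y₂ := g ∘ (↑)) ⟨(hf s).domRestrict, by rw [hfτ]; rfl⟩
    ⟨(hg s).domRestrict, by rw [hgτ]; rfl⟩
  exact congrFun this ⟨s, mem_connectedComponent⟩

theorem mapsTo_connectedComponent_of_continuousOn {f : X → Y} {s : X}
    (hf : ContinuousOn f (connectedComponent s)) :
    MapsTo f (connectedComponent s) (connectedComponent (f s)) := by
  rw [mapsTo_iff_image_subset]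
  exact (isPreconnected_connectedComponent.image f hf).subset_connectedComponent
    (mem_image_of_mem f mem_connectedComponent)

end Topology

/-! ### Slice charts and the identity theorem -/

/-- The splitting of `ℂ^N` into its first `n` and its last `N - n` coordinates. -/
noncomputable def splitEquiv {n N : ℕ} (h : n ≤ N) :
    CSpace N ≃L[ℂ] CSpace n × CSpace (N - n) :=
  LinearEquiv.toContinuousLinearEquiv
    { toFun := fun w => (WithLp.toLp 2 fun i => w (Fin.castLE h i),
        WithLp.toLp 2 fun j => w ⟨n + j, by omega⟩)
      map_add' := fun _ _ => rfl
      map_smul' := fun _ _ => rfl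
      invFun := fun p => WithLp.toLp 2 fun i =>
        if hi : (i : ℕ) < n then p.1 ⟨i, hi⟩ else p.2 ⟨i - n, by omega⟩
      left_inv := fun w => by
        ext i
        by_cases hi : (i : ℕ) < n
        · simp [hi]
        · have : n + ((i : ℕ) - n) = i := by omega
          simp [hi, this]
      right_inv := fun p => by
        ext i <;> simp }

theorem splitEquiv_snd_eq_zero {n N : ℕ} (h : n ≤ N) (w : CSpace N) :
    (splitEquiv h w).2 = 0 ↔ ∀ i : Fin N, n ≤ (i : ℕ) → w i = 0 := by
  constructor
  · intro hw i hi
    have hw' : w ⟨n + (i - n), by omega⟩ = 0 :=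
      congrArg (fun v : CSpace (N - n) => v ⟨i - n, by omega⟩) hw
    simpa [Nat.add_sub_cancel' hi] using hw'
  · intro hw
    ext j
    exact hw ⟨n + j, by omega⟩ (by simp)

section Slice

open Set Filter

variable {N n : ℕ} {M₀ : Type*} [TopologicalSpace M₀] [ChartedSpace (CSpace N) M₀]

/-- A holomorphic chart of `M₀`, with the coordinates split into the first `n` and the last `N - n`
ones, in which `S` is the slice where the last coordinates vanish. -/
structure IsSliceChart (h : n ≤ N) (S : Set M₀)
    (θ : OpenPartialHomeomorph M₀ (CSpace n × CSpace (N - n))) : Prop where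
  mem_maximalAtlas : θ.transHomeomorph (splitEquiv h).symm.toHomeomorph ∈
    IsManifold.maximalAtlas 𝓘(ℂ, CSpace N) ω M₀
  mem_iff : ∀ q ∈ θ.source, (q ∈ S ↔ (θ q).2 = 0)

variable {h : n ≤ N} {S T : Set M₀} {x : M₀}
  {θ θ' : OpenPartialHomeomorph M₀ (CSpace n × CSpace (N - n))}

theorem IsComplexSubmanifold.exists_isSliceChart (hS : IsComplexSubmanifold N n S) (h : n ≤ N)
    (hx : x ∈ S) : ∃ θ, x ∈ θ.source ∧ IsSliceChart h S θ := by
  obtain ⟨ψ, hψ, hxψ, hiff⟩ := hS x hx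
  refine ⟨ψ.transHomeomorph (splitEquiv h).toHomeomorph, hxψ, ?_, fun q hq => ?_⟩
  · convert hψ
    ext q <;> simp
  · rw [hiff q hq]
    exact (splitEquiv_snd_eq_zero h (ψ q)).symm

theorem isComplexSubmanifold_of_isSliceChart (h : n ≤ N)
    (hS : ∀ x ∈ S, ∃ θ, x ∈ θ.source ∧ IsSliceChart h S θ) : IsComplexSubmanifold N n S := by
  intro x hx
  obtain ⟨θ, hxθ, hθ⟩ := hS x hx
  refine ⟨_, hθ.mem_maximalAtlas, hxθ, fun q hq => ?_⟩
  rw [hθ.mem_iff q hq, ← splitEquiv_snd_eq_zero h]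
  simp

theorem IsComplexSubmanifold.inter_isOpen (hS : IsComplexSubmanifold N n S) {U : Set M₀}
    (hU : IsOpen U) : IsComplexSubmanifold N n (S ∩ U) := by
  rintro p ⟨hpS, hpU⟩
  obtain ⟨ψ, hψ, hpψ, hiff⟩ := hS p hpS
  refine ⟨ψ.restr U, restr_mem_maximalAtlas _ hψ hU, ?_, fun q hq => ?_⟩
  · simpa [hU.interior_eq] using ⟨hpψ, hpU⟩
  · simp only [OpenPartialHomeomorph.restr_source, hU.interior_eq] at hq
    rw [OpenPartialHomeomorph.restr_apply, ← hiff q hq.1]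
    exact and_iff_left hq.2

namespace IsSliceChart

theorem contDiffOn_transition (hθ : IsSliceChart h S θ) (hθ' : IsSliceChart h T θ') :
    ContDiffOn ℂ ω (θ' ∘ θ.symm) (θ.target ∩ θ.symm ⁻¹' θ'.source) := by
  have key := contMDiffOn_of_mem_contDiffGroupoid
    (StructureGroupoid.compatible_of_mem_maximalAtlas hθ.mem_maximalAtlas hθ'.mem_maximalAtlas)
  rw [contMDiffOn_iff_contDiffOn] at key
  have key2 := ((splitEquiv h).contDiff (n := ω)).comp_contDiffOn
    (key.comp ((splitEquiv h).symm.contDiff (n := ω)).contDiffOn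
      (s := θ.target ∩ θ.symm ⁻¹' θ'.source) (fun p hp => by simpa using hp))
  refine key2.congr fun p hp => ?_
  simp

theorem apply_mem (hθ : IsSliceChart h S θ) (hx : x ∈ θ.source) (hxS : x ∈ S) :
    θ.symm ((θ x).1, 0) = x := by
  rw [← (hθ.mem_iff x hx).1 hxS]
  exact θ.left_inv hx

theorem symm_mem (hθ : IsSliceChart h S θ) {a : CSpace n} (ha : (a, 0) ∈ θ.target) :
    θ.symm (a, 0) ∈ S := by
  rw [hθ.mem_iff _ (θ.map_target ha), θ.right_inv ha]

theorem mk_mem_target (hθ : IsSliceChart h S θ) (hx : x ∈ θ.source) (hxS : x ∈ S) :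
    ((θ x).1, 0) ∈ θ.target := by
  rw [← (hθ.mem_iff x hx).1 hxS]
  exact θ.map_source hx

end IsSliceChart

/-- Identity theorem: near a common point, `S` is contained in `T` if this is so in a neighbourhood
of one point of `S`. -/
theorem IsComplexSubmanifold.exists_nhds_inter_subset (hS : IsComplexSubmanifold N n S)
    (hT : IsComplexSubmanifold N n T) (h : n ≤ N) (hxS : x ∈ S) (hxT : x ∈ T) :
    ∃ W ∈ 𝓝 x, ∀ y ∈ S ∩ W, (∀ᶠ z in 𝓝 y, z ∈ S → z ∈ T) → S ∩ W ⊆ T := by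
  obtain ⟨θ, hxθ, hθ⟩ := hS.exists_isSliceChart h hxS
  obtain ⟨θ', hxθ', hθ'⟩ := hT.exists_isSliceChart h hxT
  let ι : CSpace n → CSpace n × CSpace (N - n) := fun a => (a, 0)
  have hι : Continuous ι := by fun_prop
  have hιd : ContDiff ℂ ω ι := contDiff_id.prodMk contDiff_const
  have hAo : IsOpen (ι ⁻¹' (θ.target ∩ θ.symm ⁻¹' θ'.source)) :=
    (θ.isOpen_inter_preimage_symm θ'.open_source).preimage hι
  have hxA : (θ x).1 ∈ ι ⁻¹' (θ.target ∩ θ.symm ⁻¹' θ'.source) := by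
    refine ⟨hθ.mk_mem_target hxθ hxS, ?_⟩
    change θ.symm ((θ x).1, 0) ∈ θ'.source
    rwa [hθ.apply_mem hxθ hxS]
  obtain ⟨r, hr, hball⟩ := Metric.isOpen_iff.1 hAo _ hxA
  -- On the ball, `g a = 0` says exactly that the point of `S` with coordinate `a` lies in `T`.
  let g : CSpace n → CSpace (N - n) := fun a => (θ' (θ.symm (ι a))).2
  have hg : AnalyticOnNhd ℂ g (Metric.ball (θ x).1 r) := by
    rw [← Metric.isOpen_ball.analyticOn_iff_analyticOnNhd,
      ← contDiffOn_omega_iff_analyticOn Metric.isOpen_ball.uniqueDiffOn]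
    exact contDiff_snd.comp_contDiffOn
      ((hθ.contDiffOn_transition hθ').comp hιd.contDiffOn hball)
  -- The neighbourhood is fixed before `y`; its points in `S` are parametrized by the ball, which is
  -- connected.
  refine ⟨θ.source ∩ θ ⁻¹' (Prod.fst ⁻¹' Metric.ball (θ x).1 r),
    (θ.isOpen_inter_preimage (Metric.isOpen_ball.preimage continuous_fst)).mem_nhds
      ⟨hxθ, Metric.mem_ball_self hr⟩, ?_⟩
  rintro y ⟨hyS, hyθ, hyr⟩ hy z ⟨hzS, hzθ, hzr⟩
  have hcont : ContinuousAt (fun a => θ.symm (ι a)) (θ y).1 :=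
    ContinuousAt.comp (f := ι) (θ.continuousAt_symm (hθ.mk_mem_target hyθ hyS)) hι.continuousAt
  have hgy : g =ᶠ[𝓝 (θ y).1] 0 := by
    have h1 : ∀ᶠ a in 𝓝 (θ y).1, θ.symm (ι a) ∈ S → θ.symm (ι a) ∈ T := by
      refine hcont.eventually (p := fun z => z ∈ S → z ∈ T) ?_
      change ∀ᶠ z in 𝓝 (θ.symm ((θ y).1, 0)), _
      rwa [hθ.apply_mem hyθ hyS]
    filter_upwards [h1, Metric.isOpen_ball.mem_nhds hyr] with a ha har
    exact (hθ'.mem_iff _ (hball har).2).1 (ha (hθ.symm_mem (hball har).1))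
  have := hg.eqOn_zero_of_preconnected_of_eventuallyEq_zero
    (convex_ball _ _).isPreconnected hyr hgy hzr
  rw [← hθ.apply_mem hzθ hzS]
  exact (hθ'.mem_iff _ (hball hzr).2).2 this

/-- Submanifolds of the same dimension, one of which is contained in the other near a common point,
coincide near this point. -/
theorem IsComplexSubmanifold.eventuallyEq_of_subset (hS : IsComplexSubmanifold N n S)
    (hT : IsComplexSubmanifold N n T) (h : n ≤ N) (hxS : x ∈ S) (hxT : x ∈ T)
    (hST : ∀ᶠ z in 𝓝 x, z ∈ S → z ∈ T) : S =ᶠ[𝓝 x] T := by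
  obtain ⟨θ, hxθ, hθ⟩ := hS.exists_isSliceChart h hxS
  obtain ⟨θ', hxθ', hθ'⟩ := hT.exists_isSliceChart h hxT
  have hAo : IsOpen (θ.target ∩ θ.symm ⁻¹' θ'.source) :=
    θ.isOpen_inter_preimage_symm θ'.open_source
  have hBo : IsOpen (θ'.target ∩ θ'.symm ⁻¹' θ.source) :=
    θ'.isOpen_inter_preimage_symm θ.open_source
  let a₀ : CSpace n := (θ x).1
  have ha₀ : θ.symm (a₀, 0) = x := hθ.apply_mem hxθ hxS
  have ha₀t : (a₀, 0) ∈ θ.target := hθ.mk_mem_target hxθ hxS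
  have ha₀A : (a₀, (0 : CSpace (N - n))) ∈ θ.target ∩ θ.symm ⁻¹' θ'.source :=
    ⟨ha₀t, by rw [mem_preimage, ha₀]; exact hxθ'⟩
  let Θ := θ' ∘ θ.symm
  let Θ' := θ ∘ θ'.symm
  have hΘa₀ : Θ (a₀, 0) = θ' x := by simp [Θ, ha₀]
  have hΘ : ContDiffAt ℂ ω Θ (a₀, 0) :=
    (hθ.contDiffOn_transition hθ').contDiffAt (hAo.mem_nhds ha₀A)
  have hΘ' : ContDiffAt ℂ ω Θ' (Θ (a₀, 0)) := by
    rw [hΘa₀]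
    refine (hθ'.contDiffOn_transition hθ).contDiffAt (hBo.mem_nhds ⟨θ'.map_source hxθ', ?_⟩)
    rw [mem_preimage, θ'.left_inv hxθ']
    exact hxθ
  have hω : (ω : WithTop ℕ∞) ≠ 0 := by simp
  have hΘf := (hΘ.differentiableAt hω).hasFDerivAt
  have hΘf' := (hΘ'.differentiableAt hω).hasFDerivAt
  have hinv : Θ' ∘ Θ =ᶠ[𝓝 (a₀, 0)] id := by
    filter_upwards [hAo.mem_nhds ha₀A] with p hp
    simp [Θ, Θ', θ'.left_inv hp.2, θ.right_inv hp.1]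
  -- Differentiating `Θ' ∘ Θ = id` gives the derivative of `Θ` a left inverse.
  have hcomp := (hΘf'.comp _ hΘf).unique ((hasFDerivAt_id _).congr_of_eventuallyEq hinv)
  let ι : CSpace n →L[ℂ] CSpace n × CSpace (N - n) := ContinuousLinearMap.inl ℂ _ _
  have hΘι : HasFDerivAt (fun a => Θ (ι a)) ((fderiv ℂ Θ (a₀, 0)).comp ι) a₀ :=
    HasFDerivAt.comp a₀ (f := ι) hΘf ι.hasFDerivAt
  have hι : ContinuousAt (fun a => θ.symm (ι a)) a₀ :=
    ContinuousAt.comp (f := ι) (θ.continuousAt_symm ha₀t) ι.continuous.continuousAt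
  have hnear : ∀ᶠ a in 𝓝 a₀, (ι a) ∈ θ.target ∩ θ.symm ⁻¹' θ'.source :=
    ι.continuous.continuousAt.eventually (hAo.mem_nhds ha₀A)
  have hsnd : ∀ᶠ a in 𝓝 a₀, (Θ (ι a)).2 = 0 := by
    have h1 : ∀ᶠ a in 𝓝 a₀, θ.symm (ι a) ∈ S → θ.symm (ι a) ∈ T := by
      refine hι.eventually (p := fun z => z ∈ S → z ∈ T) ?_
      change ∀ᶠ z in 𝓝 (θ.symm (a₀, 0)), _
      rwa [ha₀]
    filter_upwards [h1, hnear] with a ha haA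
    exact (hθ'.mem_iff _ haA.2).1 (ha (hθ.symm_mem haA.1))
  -- Near `a₀`, `Θ` maps ℂ^n × 0 into itself, so the derivative of `H` inherits injectivity. Being
  -- an endomorphism of ℂ^n it is surjective, so `H` covers a neighbourhood of `H a₀`: points of `S`
  -- fill up `T` near `x`.
  let H : CSpace n → CSpace n := fun a => (Θ (ι a)).1
  have hHs : HasStrictFDerivAt H (fderiv ℂ H a₀) a₀ := by
    refine ContDiffAt.hasStrictFDerivAt (n := ω) ?_ hω
    exact contDiff_fst.contDiffAt.comp a₀ (ContDiffAt.comp (f := ι) a₀ hΘ ι.contDiff.contDiffAt)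
  have hHf : HasFDerivAt H
      ((ContinuousLinearMap.fst ℂ _ _).comp ((fderiv ℂ Θ (a₀, 0)).comp ι)) a₀ :=
    (ContinuousLinearMap.fst ℂ (CSpace n) (CSpace (N - n))).hasFDerivAt.comp a₀ hΘι
  have h2 : (ContinuousLinearMap.snd ℂ _ _).comp ((fderiv ℂ Θ (a₀, 0)).comp ι) = 0 :=
    ((ContinuousLinearMap.snd ℂ (CSpace n) (CSpace (N - n))).hasFDerivAt.comp a₀ hΘι).unique
      ((hasFDerivAt_const 0 a₀).congr_of_eventuallyEq hsnd)
  have hinj : Function.Injective (fderiv ℂ H a₀) := by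
    rw [injective_iff_map_eq_zero]
    intro v hv
    rw [hHf.fderiv] at hv
    have hv0 : fderiv ℂ Θ (a₀, 0) (ι v) = 0 := Prod.ext hv (DFunLike.congr_fun h2 v)
    have := DFunLike.congr_fun hcomp (ι v)
    simp only [ContinuousLinearMap.comp_apply, hv0, map_zero] at this
    exact (congrArg Prod.fst this).symm
  have hsurj : (fderiv ℂ H a₀).range = ⊤ :=
    LinearMap.range_eq_top.2 ((fderiv ℂ H a₀).toLinearMap.surjective_of_injective hinj)
  have hmap := hHs.map_nhds_eq_of_surj hsurj
  have himage : ∀ᶠ b in 𝓝 (H a₀), ∃ a, H a = b ∧ (Θ (ι a)).2 = 0 ∧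
      ι a ∈ θ.target ∩ θ.symm ⁻¹' θ'.source := by
    rw [← hmap, eventually_map]
    filter_upwards [hsnd, hnear] with a h1 h2
    exact ⟨a, rfl, h1, h2⟩
  have hHx : H a₀ = (θ' x).1 := congrArg Prod.fst hΘa₀
  have hev : ∀ᶠ z in 𝓝 x, ∃ a, H a = (θ' z).1 ∧ (Θ (ι a)).2 = 0 ∧
      ι a ∈ θ.target ∩ θ.symm ⁻¹' θ'.source := by
    have hc : ContinuousAt (fun z => (θ' z).1) x :=
      continuous_fst.continuousAt.comp (θ'.continuousAt hxθ')
    rw [hHx] at himage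
    exact hc.eventually himage
  rw [eventuallyEq_set]
  filter_upwards [hST, hev, θ'.open_source.mem_nhds hxθ'] with z hz ⟨a, ha1, ha2, ha⟩ hzθ'
  refine ⟨hz, fun hzT => ?_⟩
  have hΘa : θ' (θ.symm (ι a)) = θ' z :=
    Prod.ext ha1 (ha2.trans ((hθ'.mem_iff z hzθ').1 hzT).symm)
  rw [← θ'.injOn ha.2 hzθ' hΘa]
  exact hθ.symm_mem ha.1

end Slice

/-! ### Topology of the germ space -/

namespace GermSpace

section Germs

open Set Filter

variable {N n : ℕ} {M₀ : Type*} [TopologicalSpace M₀] [ChartedSpace (CSpace N) M₀]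
  {S T : Set M₀} {x : M₀}

theorem _root_.Filter.eventuallyEq_set_iff_exists_inter {α : Type*} {l : Filter α} {A B : Set α} :
    A =ᶠ[l] B ↔ ∃ W ∈ l, A ∩ W = B ∩ W := by
  rw [eventuallyEq_set, eventually_iff_exists_mem]
  simp only [Set.ext_iff, mem_inter_iff, and_congr_left_iff]

theorem germ_eq_germ_iff (hS : IsComplexSubmanifold N n S) (hT : IsComplexSubmanifold N n T)
    (hxS : x ∈ S) (hxT : x ∈ T) : germ S hS x hxS = germ T hT x hxT ↔ S =ᶠ[𝓝 x] T := by
  have h1 : germ S hS x hxS = germ T hT x hxT ↔ ∃ W ∈ 𝓝 x, S ∩ W = T ∩ W := by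
    constructor
    · intro h
      exact Quotient.exact (eq_of_heq (Sigma.mk.inj h).2)
    · intro h
      exact congrArg (Sigma.mk x) (Quotient.sound h)
  rw [h1, eventuallyEq_set_iff_exists_inter]

theorem exists_eq_germ (s : GermSpace N n M₀) :
    ∃ (x : M₀) (S : Set M₀) (hS : IsComplexSubmanifold N n S) (hx : x ∈ S),
      s = germ S hS x hx := by
  obtain ⟨x, q⟩ := s
  obtain ⟨⟨S, hS, hx⟩, rfl⟩ := Quotient.exists_rep q
  exact ⟨x, S, hS, hx, rfl⟩

theorem mem_germsOf (hS : IsComplexSubmanifold N n S) (hxS : x ∈ S) :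
    germ S hS x hxS ∈ germsOf S hS :=
  ⟨x, hxS, rfl⟩

theorem proj_mem_of_mem_germsOf {hS : IsComplexSubmanifold N n S} {s : GermSpace N n M₀}
    (hs : s ∈ germsOf S hS) : s.proj ∈ S := by
  obtain ⟨x, hx, rfl⟩ := hs
  exact hx

theorem eq_germ_of_mem_germsOf {hS : IsComplexSubmanifold N n S} {s : GermSpace N n M₀}
    (hs : s ∈ germsOf S hS) : s = germ S hS s.proj (proj_mem_of_mem_germsOf hs) := by
  obtain ⟨x, hx, rfl⟩ := hs
  rfl

theorem isOpen_germsOf (hS : IsComplexSubmanifold N n S) : IsOpen (germsOf S hS) :=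
  TopologicalSpace.isOpen_generateFrom_of_mem ⟨S, hS, rfl⟩

theorem germ_mem_germsOf_inter (hS : IsComplexSubmanifold N n S) {U : Set M₀} (hU : IsOpen U)
    (hxS : x ∈ S) (hxU : x ∈ U) : germ S hS x hxS ∈ germsOf (S ∩ U) (hS.inter_isOpen hU) := by
  have hx : x ∈ S ∩ U := ⟨hxS, hxU⟩
  rw [(germ_eq_germ_iff hS (hS.inter_isOpen hU) hxS hx).2]
  · exact mem_germsOf _ _
  · rw [eventuallyEq_set_iff_exists_inter]
    exact ⟨U, hU.mem_nhds hxU, by rw [inter_assoc, inter_self]⟩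

theorem continuous_proj : Continuous (proj : GermSpace N n M₀ → M₀) := by
  refine continuous_def.2 fun U hU => isOpen_iff_mem_nhds.2 fun s hs => ?_
  obtain ⟨x, S, hS, hx, rfl⟩ := exists_eq_germ s
  have hSU := hS.inter_isOpen hU
  refine mem_of_superset ((isOpen_germsOf hSU).mem_nhds ?_) fun t ht =>
    (proj_mem_of_mem_germsOf ht).2
  exact germ_mem_germsOf_inter hS hU hx hs

/-- If `[S]_x` lies in `V_T`, then `S` and `T` agree on an open neighbourhood of x, hence have equal
germs at every point of `S` close to x. So each subbasic neighbourhood contains a piece of `V_S`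
over a neighbourhood of x. -/
theorem nhds_germ (hS : IsComplexSubmanifold N n S) (hxS : x ∈ S) :
    𝓝 (germ S hS x hxS) = comap proj (𝓝 x) ⊓ 𝓟 (germsOf S hS) := by
  apply le_antisymm
  · refine le_inf ?_ (le_principal_iff.2 ((isOpen_germsOf hS).mem_nhds (mem_germsOf _ _)))
    exact tendsto_iff_comap.1 (continuous_proj.tendsto (germ S hS x hxS))
  · rw [TopologicalSpace.nhds_generateFrom]
    refine le_iInf₂ fun V hV => le_principal_iff.2 ?_
    obtain ⟨hsV, T, hT, rfl⟩ := hV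
    have hxT : x ∈ T := proj_mem_of_mem_germsOf hsV
    have hST : S =ᶠ[𝓝 x] T :=
      (germ_eq_germ_iff hS hT hxS hxT).1 (eq_germ_of_mem_germsOf hsV)
    rw [mem_inf_principal, mem_comap]
    refine ⟨_, hST.eventuallyEq_nhds, fun t (ht : S =ᶠ[𝓝 t.proj] T) htS => ?_⟩
    have htT : t.proj ∈ T := (eventuallyEq_set.1 ht).self_of_nhds.1 (proj_mem_of_mem_germsOf htS)
    rw [eq_germ_of_mem_germsOf htS, (germ_eq_germ_iff _ hT _ htT).2 ht]
    exact mem_germsOf _ _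

theorem tendsto_germ_iff {α : Type*} {l : Filter α} {g : α → GermSpace N n M₀}
    (hS : IsComplexSubmanifold N n S) (hxS : x ∈ S) :
    Tendsto g l (𝓝 (germ S hS x hxS)) ↔
      Tendsto (fun a => (g a).proj) l (𝓝 x) ∧ ∀ᶠ a in l, g a ∈ germsOf S hS := by
  rw [nhds_germ, tendsto_inf, tendsto_comap_iff, tendsto_principal]
  rfl

theorem isInducing_proj_restrict (hS : IsComplexSubmanifold N n S) :
    Topology.IsInducing fun s : germsOf S hS => (s : GermSpace N n M₀).proj := by
  rw [Topology.isInducing_iff_nhds]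
  rintro ⟨s, hs⟩
  have h1 := nhds_germ hS (proj_mem_of_mem_germsOf hs)
  rw [← eq_germ_of_mem_germsOf hs] at h1
  rw [nhds_subtype_eq_comap, h1, comap_inf, comap_comap, comap_principal]
  simp [Function.comp_def]

/-- Over distinct base points, separation comes from `M₀`. Over the same point, inseparable germs
would share a germ at some point of the neighbourhoods given by the identity theorem; applying it in
both directions makes them equal. -/
theorem t2Space [T2Space M₀] (h : n ≤ N) : T2Space (GermSpace N n M₀) := by
  refine t2_iff_nhds.2 fun {s t} hne => ?_
  obtain ⟨x, S, hS, hxS, hs'⟩ := exists_eq_germ s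
  obtain ⟨y, T, hT, hyT, ht'⟩ := exists_eq_germ t
  have hxy : x = y := by
    refine t2_iff_nhds.1 inferInstance ((hne.map proj).mono (map_inf_le.trans (inf_le_inf ?_ ?_)))
    · rw [hs']
      exact continuous_proj.tendsto (germ S hS x hxS)
    · rw [ht']
      exact continuous_proj.tendsto (germ T hT y hyT)
  subst hxy
  rw [hs', ht', germ_eq_germ_iff]
  obtain ⟨W, hW, hWST⟩ := hS.exists_nhds_inter_subset hT h hxS hyT
  obtain ⟨W', hW', hWTS⟩ := hT.exists_nhds_inter_subset hS h hyT hxS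
  have hWs : proj ⁻¹' (W ∩ W') ∩ germsOf S hS ∈ 𝓝 s := by
    rw [hs', nhds_germ]
    exact inter_mem_inf (preimage_mem_comap (inter_mem hW hW')) (mem_principal_self _)
  have hTt : germsOf T hT ∈ 𝓝 t := by
    rw [ht']
    exact (isOpen_germsOf hT).mem_nhds (mem_germsOf _ _)
  obtain ⟨r, ⟨⟨hrW, hrW'⟩, hrS⟩, hrT⟩ := hne.nonempty_of_mem (inter_mem_inf hWs hTt)
  have hr := (eq_germ_of_mem_germsOf hrS).symm.trans (eq_germ_of_mem_germsOf hrT)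
  rw [germ_eq_germ_iff, eventuallyEq_set] at hr
  have h1 := hWST _ ⟨proj_mem_of_mem_germsOf hrS, hrW⟩ (hr.mono fun z hz => hz.1)
  have h2 := hWTS _ ⟨proj_mem_of_mem_germsOf hrT, hrW'⟩ (hr.mono fun z hz => hz.2)
  rw [eventuallyEq_set]
  filter_upwards [hW, hW'] with z hz hz'
  exact ⟨fun hzS => h1 ⟨hzS, hz⟩, fun hzT => h2 ⟨hzT, hz'⟩⟩

/-- If `S` is relatively closed in `U`, then so is the set of germs of `S` in the preimage
of `U`. -/
theorem closure_germsOf_inter_subset [T2Space M₀] (h : n ≤ N) (hS : IsComplexSubmanifold N n S)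
    {U : Set M₀} (hSU : closure S ∩ U ⊆ S) :
    closure (germsOf S hS) ∩ proj ⁻¹' U ⊆ germsOf S hS := by
  rintro t ⟨ht, htU⟩
  have := t2Space (M₀ := M₀) h
  have htS : t.proj ∈ S := by
    refine hSU ⟨?_, htU⟩
    exact map_mem_closure continuous_proj ht fun s hs => proj_mem_of_mem_germsOf hs
  have hne : (𝓝[germsOf S hS] t).NeBot := mem_closure_iff_nhdsWithin_neBot.1 ht
  -- The filter of points of `V_S` near `t` converges both to `t` and to the germ of `S` at
  -- `t.proj`.
  have h1 : Tendsto id (𝓝[germsOf S hS] t) (𝓝 (germ S hS t.proj htS)) :=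
    (tendsto_germ_iff hS htS).2 ⟨continuous_proj.continuousAt.mono_left nhdsWithin_le_nhds,
      self_mem_nhdsWithin⟩
  rw [tendsto_nhds_unique (tendsto_id.mono_right nhdsWithin_le_nhds) h1]
  exact mem_germsOf _ _

end Germs

end GermSpace

/-! ### Charts of the germ space and manifold structure of the leaves -/

namespace GermSpace

section Charts

open Set Filter

variable {N n : ℕ} {M₀ : Type*} [TopologicalSpace M₀] [ChartedSpace (CSpace N) M₀]
  {h : n ≤ N} {S T : Set M₀} {x : M₀}
  {θ θ' : OpenPartialHomeomorph M₀ (CSpace n × CSpace (N - n))}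

open Classical in
/-- The chart of the germ space given by a slice chart of `S`. The germ `s₀` is only used as a
value of the inverse outside of its domain. -/
noncomputable def germChart (hS : IsComplexSubmanifold N n S) (hθ : IsSliceChart h S θ)
    (s₀ : GermSpace N n M₀) : OpenPartialHomeomorph (GermSpace N n M₀) (CSpace n) where
  toFun s := (θ s.proj).1
  invFun a := if ha : (a, 0) ∈ θ.target then germ S hS (θ.symm (a, 0)) (hθ.symm_mem ha) else s₀
  source := germsOf S hS ∩ proj ⁻¹' θ.source
  target := {a | (a, 0) ∈ θ.target}
  map_source' := fun _ hs => hθ.mk_mem_target hs.2 (proj_mem_of_mem_germsOf hs.1)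
  map_target' := fun a ha => by
    rw [dif_pos (by exact ha)]
    exact ⟨mem_germsOf _ _, θ.map_target ha⟩
  left_inv' := fun s hs => by
    have hsS := proj_mem_of_mem_germsOf hs.1
    rw [dif_pos (hθ.mk_mem_target hs.2 hsS)]
    have (y : M₀) (hy : y ∈ S) (z : M₀) (hz : z ∈ S) (hyz : y = z) :
        germ S hS y hy = germ S hS z hz := by subst hyz; rfl
    exact (this _ _ _ _ (hθ.apply_mem hs.2 hsS)).trans (eq_germ_of_mem_germsOf hs.1).symm
  right_inv' := fun a ha => by
    rw [dif_pos (by exact ha)]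
    exact congrArg Prod.fst (θ.right_inv ha)
  open_source := (isOpen_germsOf hS).inter (θ.open_source.preimage continuous_proj)
  open_target := θ.open_target.preimage (by fun_prop)
  continuousOn_toFun := continuous_fst.comp_continuousOn
    (θ.continuousOn.comp continuous_proj.continuousOn fun _ hs => hs.2)
  continuousOn_invFun := by
    intro a ha
    have ha' : (a, (0 : CSpace (N - n))) ∈ θ.target := ha
    have hnear : ∀ᶠ b : CSpace n in 𝓝 a, (b, (0 : CSpace (N - n))) ∈ θ.target :=
      (θ.open_target.preimage (by fun_prop : Continuous fun b : CSpace n =>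
        (b, (0 : CSpace (N - n))))).mem_nhds ha
    refine ContinuousAt.continuousWithinAt ?_
    rw [ContinuousAt, dif_pos ha', tendsto_germ_iff]
    constructor
    · have hc : ContinuousAt (fun b : CSpace n => θ.symm (b, 0)) a :=
        ContinuousAt.comp (f := fun b : CSpace n => (b, (0 : CSpace (N - n))))
          (θ.continuousAt_symm ha') (by fun_prop)
      refine hc.tendsto.congr' ?_
      filter_upwards [hnear] with b hb
      rw [dif_pos hb]
      rfl
    · filter_upwards [hnear] with b hb
      rw [dif_pos hb]
      exact mem_germsOf _ _

theorem germChart_apply (hS : IsComplexSubmanifold N n S) (hθ : IsSliceChart h S θ)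
    (s₀ s : GermSpace N n M₀) : germChart hS hθ s₀ s = (θ s.proj).1 := rfl

theorem germChart_source (hS : IsComplexSubmanifold N n S) (hθ : IsSliceChart h S θ)
    (s₀ : GermSpace N n M₀) :
    (germChart hS hθ s₀).source = germsOf S hS ∩ proj ⁻¹' θ.source := rfl

theorem mem_germChart_target (hS : IsComplexSubmanifold N n S) (hθ : IsSliceChart h S θ)
    (s₀ : GermSpace N n M₀) {a : CSpace n} :
    a ∈ (germChart hS hθ s₀).target ↔ (a, 0) ∈ θ.target := Iff.rfl

theorem proj_germChart_symm (hS : IsComplexSubmanifold N n S) (hθ : IsSliceChart h S θ)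
    (s₀ : GermSpace N n M₀) {a : CSpace n} (ha : (a, 0) ∈ θ.target) :
    ((germChart hS hθ s₀).symm a).proj = θ.symm (a, 0) := by
  have : (germChart hS hθ s₀).symm a = germ S hS (θ.symm (a, 0)) (hθ.symm_mem ha) := dif_pos ha
  rw [this]
  rfl

theorem exists_germChart (h : n ≤ N) (s : GermSpace N n M₀) :
    ∃ (S : Set M₀) (hS : IsComplexSubmanifold N n S)
      (θ : OpenPartialHomeomorph M₀ (CSpace n × CSpace (N - n))) (hθ : IsSliceChart h S θ),
      s ∈ (germChart hS hθ s).source := by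
  obtain ⟨x, S, hS, hx, hs⟩ := exists_eq_germ s
  obtain ⟨θ, hxθ, hθ⟩ := hS.exists_isSliceChart h hx
  refine ⟨S, hS, θ, hθ, ?_⟩
  rw [germChart_source, hs]
  exact ⟨mem_germsOf hS hx, hxθ⟩

/-- The complex charts of the germ space, given by slice charts. -/
noncomputable abbrev chartedSpace (M₀ : Type*) [TopologicalSpace M₀] [ChartedSpace (CSpace N) M₀]
    (h : n ≤ N) : ChartedSpace (CSpace n) (GermSpace N n M₀) where
  atlas := {e | ∃ (S : Set M₀) (hS : IsComplexSubmanifold N n S)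
      (θ : OpenPartialHomeomorph M₀ (CSpace n × CSpace (N - n))) (hθ : IsSliceChart h S θ)
      (s₀ : GermSpace N n M₀), e = germChart hS hθ s₀}
  chartAt s := germChart (exists_germChart h s).choose_spec.choose
    (exists_germChart h s).choose_spec.choose_spec.choose_spec.choose s
  mem_chart_source s := (exists_germChart h s).choose_spec.choose_spec.choose_spec.choose_spec
  chart_mem_atlas _ := ⟨_, _, _, _, _, rfl⟩

/-- A transition between germ charts is a transition between slice charts, restricted to ℂ^n × 0 and
followed by the first projection. -/
theorem isManifold (h : n ≤ N) :
    let := chartedSpace M₀ h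
    IsManifold 𝓘(ℂ, CSpace n) ω (GermSpace N n M₀) := by
  let := chartedSpace M₀ h
  refine isManifold_of_contDiffOn _ _ _ ?_
  rintro _ _ ⟨S, hS, θ, hθ, s₀, rfl⟩ ⟨T, hT, θ', hθ', t₀, rfl⟩
  have hι : ContDiff ℂ ω (fun a : CSpace n => (a, (0 : CSpace (N - n)))) :=
    contDiff_id.prodMk contDiff_const
  have key : ContDiffOn ℂ ω (fun a : CSpace n => (θ' (θ.symm (a, 0))).1)
      {a : CSpace n | (a, (0 : CSpace (N - n))) ∈ θ.target ∩ θ.symm ⁻¹' θ'.source} :=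
    contDiff_fst.comp_contDiffOn
      ((hθ.contDiffOn_transition hθ').comp hι.contDiffOn fun a ha => ha)
  simp only [modelWithCornersSelf_coe, modelWithCornersSelf_coe_symm, Function.id_comp,
    Function.comp_id, preimage_id, range_id, inter_univ]
  have hsub : ∀ a ∈ ((germChart hS hθ s₀).symm ≫ₕ germChart hT hθ' t₀).source,
      (a, (0 : CSpace (N - n))) ∈ θ.target ∩ θ.symm ⁻¹' θ'.source := by
    intro a ha
    rw [OpenPartialHomeomorph.trans_source, OpenPartialHomeomorph.symm_source] at ha
    have ha1 := (mem_germChart_target hS hθ s₀).1 ha.1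
    have ha2 := ha.2.2
    rw [mem_preimage, proj_germChart_symm hS hθ s₀ ha1] at ha2
    exact ⟨ha1, ha2⟩
  refine (key.mono hsub).congr fun a ha => ?_
  rw [OpenPartialHomeomorph.coe_trans, Function.comp_apply, germChart_apply,
    proj_germChart_symm hS hθ s₀ (hsub a ha).1]

theorem isOpen_connectedComponent (h : n ≤ N) (s : GermSpace N n M₀) :
    IsOpen (connectedComponent s) := by
  let := chartedSpace M₀ h
  have := ChartedSpace.locallyConnectedSpace (CSpace n) (GermSpace N n M₀)
  exact _root_.isOpen_connectedComponent

/-- Inside a slice chart `S` is the zero set of continuous functions. This supplies the closedness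
needed for Poincaré–Volterra. -/
theorem exists_mem_germsOf_relClosed (h : n ≤ N) (s : GermSpace N n M₀) :
    ∃ (S : Set M₀) (hS : IsComplexSubmanifold N n S) (U : Set M₀), s ∈ germsOf S hS ∧
      IsOpen U ∧ s.proj ∈ U ∧ closure S ∩ U ⊆ S := by
  obtain ⟨x, S, hS, hx, rfl⟩ := exists_eq_germ s
  obtain ⟨θ, hxθ, hθ⟩ := hS.exists_isSliceChart h hx
  have hS' := hS.inter_isOpen θ.open_source
  refine ⟨S ∩ θ.source, hS', θ.source, ?_, θ.open_source, hxθ, ?_⟩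
  · exact germ_mem_germsOf_inter hS θ.open_source hx hxθ
  · rintro z ⟨hz, hzθ⟩
    refine ⟨(hθ.mem_iff z hzθ).2 ?_, hzθ⟩
    have hne : (𝓝[S ∩ θ.source] z).NeBot := mem_closure_iff_nhdsWithin_neBot.1 hz
    have hc : Tendsto (fun y => (θ y).2) (𝓝[S ∩ θ.source] z) (𝓝 (θ z).2) :=
      (continuous_snd.continuousAt.comp (θ.continuousAt hzθ)).mono_left nhdsWithin_le_nhds
    refine tendsto_nhds_unique hc (tendsto_const_nhds.congr' ?_)
    filter_upwards [self_mem_nhdsWithin] with y hy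
    exact ((hθ.mem_iff y hy.2).1 hy.1).symm

theorem secondCountableTopology_connectedComponent [T2Space M₀] [SecondCountableTopology M₀]
    (h : n ≤ N) (s : GermSpace N n M₀) : SecondCountableTopology (connectedComponent s) := by
  let := chartedSpace M₀ h
  have := ChartedSpace.locallyConnectedSpace (CSpace n) (GermSpace N n M₀)
  have := (isOpen_connectedComponent h s).locallyConnectedSpace
  have : PreconnectedSpace (connectedComponent s) :=
    Subtype.preconnectedSpace isPreconnected_connectedComponent
  refine secondCountableTopology_of_relClosed_nhds
    (f := fun p : connectedComponent s => (p : GermSpace N n M₀).proj)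
    (continuous_proj.comp continuous_subtype_val) fun p => ?_
  obtain ⟨S, hS, U, hpS, hU, hpU, hcl⟩ := exists_mem_germsOf_relClosed h (p : GermSpace N n M₀)
  let V : Set (connectedComponent s) := (↑) ⁻¹' germsOf S hS
  refine ⟨V, (isOpen_germsOf hS).preimage continuous_subtype_val, hpS, ?_, U, hU, hpU, ?_⟩
  · let j : V → germsOf S hS := fun q => ⟨q.1.1, q.2⟩
    have hj : Topology.IsInducing j := by
      rw [← Topology.IsInducing.subtypeVal.of_comp_iff]
      have h1 : Topology.IsInducing fun q : V => ((q : connectedComponent s) : GermSpace N n M₀) :=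
        Topology.IsInducing.subtypeVal.comp Topology.IsInducing.subtypeVal
      exact h1
    exact ((isInducing_proj_restrict hS).comp hj).secondCountableTopology
  · rintro q ⟨hq, hqU⟩
    exact closure_germsOf_inter_subset h hS hcl
      ⟨map_mem_closure continuous_subtype_val hq fun _ hr => hr, hqU⟩

/-- The leaf is an open subset of the germ space and inherits its charts. In a germ chart and the
slice chart defining it, the projection is a ↦ (a, 0), the normal form of an immersion. -/
theorem nonempty_leafStructure [T2Space M₀] [SecondCountableTopology M₀] (h : n ≤ N)
    (s : GermSpace N n M₀) :
    Nonempty (LeafStructure N n (proj : GermSpace N n M₀ → M₀) (connectedComponent s)) := by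
  let := chartedSpace M₀ h
  have := isManifold (M₀ := M₀) h
  have := t2Space (M₀ := M₀) h
  let O : TopologicalSpace.Opens (GermSpace N n M₀) :=
    ⟨connectedComponent s, isOpen_connectedComponent h s⟩
  have himm : Manifold.IsImmersion 𝓘(ℂ, CSpace n) 𝓘(ℂ, CSpace N) ω (fun p : O => proj p.1) := by
    refine Manifold.IsImmersionOfComplement.isImmersion (F := CSpace (N - n)) fun p => ?_
    obtain ⟨S, hS, θ, hθ, hp, hchart⟩ : ∃ (S : Set M₀) (hS : IsComplexSubmanifold N n S)
        (θ : OpenPartialHomeomorph M₀ (CSpace n × CSpace (N - n))) (hθ : IsSliceChart h S θ),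
        p.1.proj ∈ θ.source ∧ chartAt (CSpace n) p.1 = germChart hS hθ p.1 :=
      ⟨_, _, _, _, (mem_chart_source (CSpace n) p.1).2, rfl⟩
    refine Manifold.IsImmersionAtOfComplement.mk_of_continuousAt
      (continuous_proj.comp continuous_subtype_val).continuousAt (splitEquiv h).symm
      (chartAt _ p) _ (mem_chart_source _ p) hp (IsManifold.chart_mem_maximalAtlas p)
      hθ.mem_maximalAtlas fun a ha => ?_
    have ha' : a ∈ (chartAt (CSpace n) p.1).target ∧
        (((chartAt (CSpace n) p).symm a : O) : GermSpace N n M₀) =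
          (chartAt (CSpace n) p.1).symm a := by
      rw [TopologicalSpace.Opens.chartAt_eq] at ha ⊢
      have hat : a ∈ ((chartAt (CSpace n) p.1).subtypeRestr ⟨p⟩).target := by simpa using ha
      exact ⟨OpenPartialHomeomorph.subtypeRestr_target_subset _ ⟨p⟩ hat,
        OpenPartialHomeomorph.subtypeRestr_symm_apply _ ⟨p⟩ hat⟩
    rw [hchart] at ha'
    have ha'' : (a, (0 : CSpace (N - n))) ∈ θ.target := ha'.1
    have hproj := congrArg proj ha'.2
    rw [proj_germChart_symm hS hθ _ ha''] at hproj
    simp [hproj, θ.right_inv ha'']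
  exact ⟨@LeafStructure.mk _ _ _ _ _ _ _ _ _ (inferInstanceAs (T2Space O))
    (secondCountableTopology_connectedComponent h s) (inferInstanceAs (ChartedSpace (CSpace n) O))
    (inferInstanceAs (IsManifold 𝓘(ℂ, CSpace n) ω O)) himm⟩

end Charts

end GermSpace

/-! ### Images of immersions and their lifts -/

section Immersion

open Set Filter Manifold

variable {N n : ℕ} {M₀ : Type*} [TopologicalSpace M₀] [ChartedSpace (CSpace N) M₀]
  [IsManifold 𝓘(ℂ, CSpace N) ω M₀] {M : Type*} [TopologicalSpace M] [ChartedSpace (CSpace n) M] {φ : M → M₀} {p : M}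

/-- An immersion maps small neighbourhoods homeomorphically onto submanifolds. -/
theorem Manifold.IsImmersion.exists_image_isComplexSubmanifold
    (hφ : IsImmersion 𝓘(ℂ, CSpace n) 𝓘(ℂ, CSpace N) ω φ) (h : n ≤ N) (p : M) :
    ∃ U : Set M, IsOpen U ∧ p ∈ U ∧ IsComplexSubmanifold N n (φ '' U) ∧
      ∀ U' ⊆ U, IsOpen U' → ∃ W : Set M₀, IsOpen W ∧ φ '' U' = φ '' U ∩ W := by
  have hc := hφ.isImmersionOfComplement_complement p
  set F := hφ.complement
  let d := hc.domChart
  let c := hc.codChart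
  let A : (CSpace n × F) ≃L[ℂ] CSpace N := hc.equiv
  have hsource : ∀ q ∈ d.source, φ q ∈ c.source := hc.source_subset_preimage_source
  have hcφ : ∀ q ∈ d.source, c (φ q) = A (d q, 0) := by
    intro q hq
    have hdt : d q ∈ (d.extend 𝓘(ℂ, CSpace n)).target := by simpa using d.map_source hq
    have := hc.writtenInCharts hdt
    have hdq : d.symm (d q) = q := d.left_inv hq
    simpa [d, hdq] using this
  have hmem : ∀ U' ⊆ d.source, ∀ z ∈ c.source,
      (z ∈ φ '' U' ↔ (A.symm (c z)).2 = 0 ∧ (A.symm (c z)).1 ∈ d.target ∩ d.symm ⁻¹' U') := by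
    intro U' hU' z hz
    constructor
    · rintro ⟨q, hq, rfl⟩
      rw [hcφ q (hU' hq), A.symm_apply_apply]
      refine ⟨rfl, d.map_source (hU' hq), ?_⟩
      rw [mem_preimage, d.left_inv (hU' hq)]
      exact hq
    · rintro ⟨h2, h1, hU⟩
      refine ⟨_, hU, c.injOn (hsource _ (d.map_target h1)) hz ?_⟩
      rw [hcφ _ (d.map_target h1), d.right_inv h1, ← h2]
      exact A.apply_symm_apply (c z)
  have hopen : ∀ U' : Set M, IsOpen U' → IsOpen
      (c.source ∩ c ⁻¹' (A.symm ⁻¹' (Prod.fst ⁻¹' (d.target ∩ d.symm ⁻¹' U')))) := fun U' hU' =>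
    c.isOpen_inter_preimage (((d.isOpen_inter_preimage_symm hU').preimage continuous_fst).preimage
      A.symm.continuous)
  refine ⟨d.source, d.open_source, hc.mem_domChart_source, ?_, fun U' hU' hU'o =>
    ⟨_, hopen U' hU'o, ?_⟩⟩
  · have : FiniteDimensional ℂ (CSpace n × F) := A.symm.toLinearEquiv.finiteDimensional
    have : FiniteDimensional ℂ F :=
      Module.Finite.of_surjective (LinearMap.snd ℂ (CSpace n) F) LinearMap.snd_surjective
    have hdim : Module.finrank ℂ F = Module.finrank ℂ (CSpace (N - n)) := by
      have h1 := A.toLinearEquiv.finrank_eq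
      rw [Module.finrank_prod, finrank_euclideanSpace_fin, finrank_euclideanSpace_fin] at h1
      rw [finrank_euclideanSpace_fin]
      omega
    let B : F ≃L[ℂ] CSpace (N - n) := ContinuousLinearEquiv.ofFinrankEq hdim
    let G : CSpace N ≃L[ℂ] CSpace n × CSpace (N - n) :=
      A.symm.trans ((ContinuousLinearEquiv.refl ℂ _).prodCongr B)
    -- Restricting to `W` forces the first coordinate into `d.target`; otherwise the slice could
    -- contain points outside `φ '' d.source`.
    let W := c.source ∩ c ⁻¹' (A.symm ⁻¹' (Prod.fst ⁻¹' (d.target ∩ d.symm ⁻¹' d.source)))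
    have hW : IsOpen W := hopen _ d.open_source
    refine isComplexSubmanifold_of_isSliceChart h fun x hx => ?_
    have hxc : x ∈ c.source := by
      obtain ⟨q, hq, rfl⟩ := hx
      exact hsource q hq
    refine ⟨(c.transHomeomorph G.toHomeomorph).restr W, ?_, ?_, fun z hz => ?_⟩
    · rw [OpenPartialHomeomorph.restr_source, hW.interior_eq]
      exact ⟨hxc, hxc, ((hmem _ subset_rfl x hxc).1 hx).2⟩
    · let E : CSpace N ≃L[ℂ] CSpace N := G.trans (splitEquiv h).symm
      have hcE : c.transHomeomorph E.toHomeomorph ∈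
          IsManifold.maximalAtlas 𝓘(ℂ, CSpace N) ω M₀ := by
        have hca : c ∈ IsManifold.maximalAtlas 𝓘(ℂ, CSpace N) ω M₀ := hc.codChart_mem_maximalAtlas
        refine OpenPartialHomeomorph.mem_maximalAtlas_of_contMDiffOn _
          (E.contDiff.contMDiff.comp_contMDiffOn (contMDiffOn_of_mem_maximalAtlas hca)) ?_
        exact (contMDiffOn_symm_of_mem_maximalAtlas hca).comp E.symm.contDiff.contMDiff.contMDiffOn
          fun w hw => hw
      exact restr_mem_maximalAtlas _ hcE hW
    · have hz' : z ∈ c.source ∧ z ∈ W := by simpa [hW.interior_eq] using hz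
      rw [hmem _ subset_rfl z hz'.1]
      have hzW : (A.symm (c z)).1 ∈ d.target ∩ d.symm ⁻¹' d.source := hz'.2.2
      change _ ↔ B (A.symm (c z)).2 = 0
      rw [and_iff_left hzW, map_eq_zero_iff B B.injective]
  · ext z
    constructor
    · intro hz
      have hzc : z ∈ c.source := by
        obtain ⟨q, hq, rfl⟩ := hz
        exact hsource q (hU' hq)
      exact ⟨image_mono hU' hz, hzc, ((hmem U' hU' z hzc).1 hz).2⟩
    · rintro ⟨hz, hzc, hzW⟩
      exact (hmem U' hU' z hzc).2 ⟨((hmem _ subset_rfl z hzc).1 hz).1, hzW⟩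

namespace GermSpace

/-- Immersions lift uniquely to the germ space. -/
theorem existsUnique_lift (h : n ≤ N) (hφ : IsImmersion 𝓘(ℂ, CSpace n) 𝓘(ℂ, CSpace N) ω φ) :
    ∃! ρ : M → GermSpace N n M₀, Continuous ρ ∧ φ = proj ∘ ρ := by
  choose U hU hpU hUS hUW using fun p => hφ.exists_image_isComplexSubmanifold h p
  let ρ : M → GermSpace N n M₀ := fun p => germ _ (hUS p) (φ p) (mem_image_of_mem φ (hpU p))
  -- Shrinking the neighbourhood in `M` does not change the germ of the image, because `φ` is open
  -- onto its image on `U p`.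
  have himage : ∀ p q (V : Set M), IsOpen V → V ⊆ U p → q ∈ V → φ '' V =ᶠ[𝓝 (φ q)] φ '' U p := by
    intro p q V hV hVU hq
    obtain ⟨W, hW, hVW⟩ := hUW p V hVU hV
    rw [eventuallyEq_set_iff_exists_inter]
    refine ⟨W, hW.mem_nhds ?_, by rw [hVW, inter_assoc, inter_self]⟩
    exact (hVW ▸ mem_image_of_mem φ hq : φ q ∈ φ '' U p ∩ W).2
  have hρU : ∀ p, ∀ q ∈ U p, ρ q ∈ germsOf _ (hUS p) := by
    intro p q hq
    have hV := (hU p).inter (hU q)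
    have h1 := himage p q _ hV inter_subset_left ⟨hq, hpU q⟩
    have h2 := himage q q _ hV inter_subset_right ⟨hq, hpU q⟩
    have : ρ q = germ _ (hUS p) (φ q) (mem_image_of_mem φ hq) :=
      (germ_eq_germ_iff _ _ _ _).2 (h2.symm.trans h1)
    rw [this]
    exact mem_germsOf _ _
  have hφc : Continuous φ := hφ.contMDiff.continuous
  refine ⟨ρ, ⟨continuous_iff_continuousAt.2 fun p => ?_, rfl⟩, ?_⟩
  · refine (tendsto_germ_iff (hUS p) (mem_image_of_mem φ (hpU p))).2 ⟨hφc.tendsto p, ?_⟩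
    filter_upwards [(hU p).mem_nhds (hpU p)] with q hq using hρU p q hq
  · rintro ρ' ⟨hρ', hφρ'⟩
    funext p
    have hp : (ρ' p).proj = φ p := (congrFun hφρ' p).symm
    obtain ⟨x, T, hT, hxT, hpT⟩ := exists_eq_germ (ρ' p)
    obtain rfl : φ p = x := by rw [← hp, hpT]; rfl
    -- By continuity `ρ'` stays in `V_T` near `p`, which forces the image of this neighbourhood into
    -- `T`.
    have hV : IsOpen (U p ∩ ρ' ⁻¹' germsOf T hT) :=
      (hU p).inter ((isOpen_germsOf hT).preimage hρ')
    have hpV : p ∈ U p ∩ ρ' ⁻¹' germsOf T hT := by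
      refine ⟨hpU p, ?_⟩
      rw [mem_preimage, hpT]
      exact mem_germsOf _ _
    have hsub : φ '' (U p ∩ ρ' ⁻¹' germsOf T hT) ⊆ T := by
      rintro _ ⟨q, hq, rfl⟩
      rw [hφρ']
      exact proj_mem_of_mem_germsOf hq.2
    rw [hpT]
    refine ((germ_eq_germ_iff _ _ _ _).2 ?_).symm
    refine (hUS p).eventuallyEq_of_subset hT h (mem_image_of_mem φ (hpU p)) hxT ?_
    filter_upwards [eventuallyEq_set.1 (himage p p _ hV inter_subset_left hpV)] with z hz hzU
    exact hsub (hz.2 hzU)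

theorem isUniversalLeafSpace.{t, a} {M₀ : Type a} [TopologicalSpace M₀] [T2Space M₀]
    [SecondCountableTopology M₀] [ChartedSpace (CSpace N) M₀]
    [IsManifold 𝓘(ℂ, CSpace N) ω M₀] (h : n ≤ N) :
    IsUniversalLeafSpace.{t, a, a} N n (proj : GermSpace N n M₀ → M₀) where
  continuous := continuous_proj
  leaf := nonempty_leafStructure h
  lift _ _ _ _ _ _ _ hφ := existsUnique_lift h hφ

end GermSpace

end Immersion

/-! ### Uniqueness of the universal pair -/

section Uniqueness

open Set Manifold

variable {N n : ℕ} {M₀ : Type u} [TopologicalSpace M₀] [ChartedSpace (CSpace N) M₀]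

theorem IsUniversalLeafSpace.existsUnique_lift_leaf {X Y : Type u} [TopologicalSpace X]
    [TopologicalSpace Y] {τ : X → M₀} {τ' : Y → M₀} (hX : IsUniversalLeafSpace.{u, u, u} N n τ)
    (hY : IsUniversalLeafSpace.{u, u, u} N n τ') (s : X) :
    ∃! ρ : connectedComponent s → Y, Continuous ρ ∧ τ ∘ (↑) = τ' ∘ ρ := by
  obtain ⟨A⟩ := hX.leaf s
  have := A.t2
  have := A.secondCountable
  let := A.charted
  have := A.isManifold
  exact hY.lift (connectedComponent s) _ A.isImmersion

/-- Two universal leaf spaces over `M₀` are equivalent if the leaves of the first one are open. -/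
theorem IsUniversalLeafSpace.exists_isLeafEquivalence {X Y : Type u} [TopologicalSpace X]
    [TopologicalSpace Y] {τ : X → M₀} {τ' : Y → M₀} (hX : IsUniversalLeafSpace.{u, u, u} N n τ)
    (hY : IsUniversalLeafSpace.{u, u, u} N n τ') (hXo : ∀ s : X, IsOpen (connectedComponent s)) :
    ∃ e : X → Y, IsLeafEquivalence N n τ τ' e ∧
      ((∀ y : Y, IsOpen (connectedComponent y)) → IsHomeomorph e) := by
  -- Self-maps over `M₀` need only be continuous on leaves to be the identity; `g` below is not
  -- known to be continuous on all of `Y`.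
  have key : ∀ {Z : Type u} [TopologicalSpace Z] {f : Z → Z} {τ'' : Z → M₀},
      IsUniversalLeafSpace.{u, u, u} N n τ'' → (∀ s, ContinuousOn f (connectedComponent s)) →
      τ'' = τ'' ∘ f → ∀ z, f z = z := by
    intro Z _ f τ'' hZ hf hfτ z
    exact congrFun (lift_unique_of_components (hZ.existsUnique_lift_leaf hZ) hf hfτ
      (fun s => continuousOn_id) rfl) z
  obtain ⟨e, he, heτ⟩ := exists_lift_of_components (hX.existsUnique_lift_leaf hY)
  obtain ⟨g, hg, hgτ⟩ := exists_lift_of_components (hY.existsUnique_lift_leaf hX)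
  have hge : ∀ x, g (e x) = x := key (f := g ∘ e) hX
    (fun s => (hg (e s)).comp (he s) (mapsTo_connectedComponent_of_continuousOn (he s)))
    (by rw [← Function.comp_assoc, ← hgτ, ← heτ])
  have heg : ∀ y, e (g y) = y := key (f := e ∘ g) hY
    (fun s => (he (g s)).comp (hg s) (mapsTo_connectedComponent_of_continuousOn (hg s)))
    (by rw [← Function.comp_assoc, ← heτ, ← hgτ])
  have hcont : ∀ {Z Z' : Type u} [TopologicalSpace Z] [TopologicalSpace Z'] {f : Z → Z'},
      (∀ s, ContinuousOn f (connectedComponent s)) → (∀ s : Z, IsOpen (connectedComponent s)) →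
      Continuous f := fun hf ho => continuous_iff_continuousAt.2 fun s =>
    (hf s).continuousAt ((ho s).mem_nhds mem_connectedComponent)
  have hec := hcont he hXo
  refine ⟨e, ⟨hec, ⟨Function.LeftInverse.injective hge, Function.RightInverse.surjective heg⟩,
    heτ, fun s A B => ?_⟩, fun hYo =>
      (Homeomorph.mk ⟨e, g, hge, heg⟩ hec (hcont hg hYo)).isHomeomorph⟩
  let := A.charted
  let := B.charted
  have hme := mapsTo_connectedComponent_of_continuousOn (he s)
  have hmg : MapsTo g (connectedComponent (e s)) (connectedComponent s) := by
    simpa only [hge] using mapsTo_connectedComponent_of_continuousOn (hg (e s))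
  refine ⟨⟨⟨hme.restrict, hmg.restrict, fun p => Subtype.ext (hge p), fun p => Subtype.ext (heg p)⟩,
    ?_, ?_⟩, fun p => rfl⟩
  -- A continuous map is holomorphic once its composite with an immersion is; here the composite is
  -- `τ` on the leaf.
  · refine (ContMDiff.iff_comp_isImmersion B.isImmersion).2 ⟨(he s).mapsToRestrict hme, ?_⟩
    convert A.isImmersion.contMDiff using 1
    funext p
    exact (congrFun heτ p).symm
  · refine (ContMDiff.iff_comp_isImmersion A.isImmersion).2 ⟨(hg (e s)).mapsToRestrict hmg, ?_⟩
    convert B.isImmersion.contMDiff using 1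
    funext p
    exact (congrFun hgτ p).symm

end Uniqueness

/-- Lifting into the germ space works for manifolds in any universe `v`. The comparison with `X`
uses the lifting property only for leaves, which live in `u`. -/
theorem theorem3p1 (N n : ℕ) (hn : 1 ≤ n) (hnN : n ≤ N)
    (M₀ : Type u) [TopologicalSpace M₀] [T2Space M₀] [SecondCountableTopology M₀]
    [ChartedSpace (CSpace N) M₀] [IsManifold 𝓘(ℂ, CSpace N) ω M₀] :
    IsUniversalLeafSpace.{v, u, u} N n (GermSpace.proj : GermSpace N n M₀ → M₀) ∧
    (∀ s : GermSpace N n M₀, IsOpen (connectedComponent s)) ∧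
    ∀ (X : Type u) [TopologicalSpace X] (τ : X → M₀),
      IsUniversalLeafSpace.{u, u, u} N n τ →
      ∃ e : GermSpace N n M₀ → X,
        IsLeafEquivalence N n GermSpace.proj τ e ∧
        ((∀ x : X, IsOpen (connectedComponent x)) → IsHomeomorph e) :=
  ⟨GermSpace.isUniversalLeafSpace hnN, GermSpace.isOpen_connectedComponent hnN, fun _ _ _ hτ =>
    (GermSpace.isUniversalLeafSpace hnN).exists_isLeafEquivalence hτ
      (GermSpace.isOpen_connectedComponent hnN)⟩
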